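/- Let $-1<q<1$, let $\mathcal H=\ell^2(\mathbb Z)$ with canonical basis $(e_i)_{i\in\mathbb Z}$, and let $\mathcal F_q$ be the $q$-deformed Fock space, i.e. the completion of the algebraic linear span of a vacuum vector $\Omega$ (the tensor of length $0$) and the vectors $f_1\otimes\cdots\otimes f_n$ ($f_s\in\mathcal H$, $n\ge1$) with respect to the inner product $$\langle f_1\otimes\cdots\otimes f_n,\,g_1\otimes\cdots\otimes g_m\rangle_q=\delta_{n,m}\sum_{\pi\in\mathbb P_n}q^{i(\pi)}\langle f_1,g_{\pi(1)}\rangle\cdots\langle f_n,g_{\pi(n)}\rangle ,$$ where $\mathbb P_n$ is the symmetric group and $i(\pi)$ is the number of inversions of $\pi$. For $f\in\mathcal H$ let $a^+(f)$ be the bounded operator on $\mathcal F_q$ with $a^+(f)\Omega=f$ and $a^+(f)(f_1\otimes\cdots\otimes f_n)=f\otimes f_1\otimes\cdots\otimes f_n$, and let $a(f)=a^+(f)^*$ be its adjoint. Let $\mathcal R_q$ be the $C^*$-algebra generated by $\{a(e_i): i\in\mathbb Z\}$, and let $\alpha$ be the automorphism of $\mathcal R_q$ determined by $\alpha(a(e_i))=a(e_{i+1})$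 for $i\in\mathbb Z$. Let $0\le k_1<k_2<\cdots$ be a strictly increasing sequence of natural numbers, let $i,j\ge0$ be integers with $i+j>0$, and let $\sigma_1,\dots,\sigma_i,\rho_1,\dots,\rho_j\in\mathbb Z$. Then for every $n$ $$\Big\|\sum_{l=1}^{n}\alpha^{k_l}\big(a^+(e_{\sigma_1})\cdots a^+(e_{\sigma_i})\,a(e_{\rho_1})\cdots a(e_{\rho_j})\big)\Big\|\le\sqrt{\frac{n}{(1-|q|)^{i+j}}}\,.$$ -/

import Mathlib

open scoped ComplexConjugate

noncomputable section

namespace QFock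

/-- The number of inversions of a permutation. -/
def inversions {n : ℕ} (π : Equiv.Perm (Fin n)) : ℕ :=
  (Finset.univ.filter fun p : Fin n × Fin n => p.1 < p.2 ∧ π p.2 < π p.1).card

section Kernel

open scoped ComplexOrder

variable {E : Type*} [NormedAddCommGroup E] [InnerProductSpace ℂ E]

/-- The `q`-inner product of the simple tensors `f₁ ⊗ ⋯ ⊗ fₙ` and `g₁ ⊗ ⋯ ⊗ gₙ`,
`∑ π, q ^ i(π) ⟨f₁, g_{π(1)}⟩ ⋯ ⟨fₙ, g_{π(n)}⟩`. Here and below inner products are conjugate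
linear in the first and linear in the second variable. -/
def kernelDeg (q : ℝ) {n : ℕ} (f g : Fin n → E) : ℂ :=
  ∑ π : Equiv.Perm (Fin n), (q : ℂ) ^ inversions π * ∏ k, inner ℂ (f k) (g (π k))

/-- A simple tensor of arbitrary degree: a number `n` and vectors `f₁, …, fₙ`. The one of degree
`0` is the vacuum. -/
abbrev Simple (E : Type*) : Type _ := Σ n : ℕ, (Fin n → E)

/-- The `q`-inner product of simple tensors, zero if the degrees differ. -/
def kernel (q : ℝ) (x y : Simple E) : ℂ :=
  if h : x.1 = y.1 then kernelDeg q x.2 (fun k => y.2 (Fin.cast h k)) else 0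

theorem kernel_same (q : ℝ) {n : ℕ} (f g : Fin n → E) :
    kernel q ⟨n, f⟩ ⟨n, g⟩ = kernelDeg q f g := by
  simp [kernel]

theorem kernel_ne (q : ℝ) {n m : ℕ} (h : n ≠ m) (f : Fin n → E) (g : Fin m → E) :
    kernel q ⟨n, f⟩ ⟨m, g⟩ = 0 := by
  simp [kernel, h]

theorem inversions_symm {n : ℕ} (π : Equiv.Perm (Fin n)) : inversions π⁻¹ = inversions π := by
  unfold inversions
  refine Finset.card_bij' (fun p _ => (π⁻¹ p.2, π⁻¹ p.1)) (fun p _ => (π p.2, π p.1)) ?_ ?_ ?_ ?_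
  all_goals simp +contextual

theorem kernelDeg_conj (q : ℝ) {n : ℕ} (f g : Fin n → E) :
    conj (kernelDeg q f g) = kernelDeg q g f := by
  unfold kernelDeg
  rw [map_sum, ← Equiv.sum_comp (Equiv.inv (Equiv.Perm (Fin n)))]
  refine Finset.sum_congr rfl fun π _ => ?_
  simp only [Equiv.inv_apply, map_mul, map_pow, Complex.conj_ofReal, map_prod, inversions_symm]
  congr 1
  rw [← Equiv.prod_comp π]
  simp

theorem kernel_conj (q : ℝ) (x y : Simple E) : conj (kernel q x y) = kernel q y x := by
  obtain ⟨n, f⟩ := x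
  obtain ⟨m, g⟩ := y
  by_cases h : n = m
  · subst h
    rw [kernel_same, kernel_same, kernelDeg_conj]
  · rw [kernel_ne q h, kernel_ne q (Ne.symm h), map_zero]

theorem posSemidef_inner {ι F : Type*} [NormedAddCommGroup F] [InnerProductSpace ℂ F]
    (v : ι → F) : (Matrix.of fun a b => (inner ℂ (v a) (v b) : ℂ)).PosSemidef := by
  refine ⟨?_, fun x => ?_⟩
  · ext a b
    simp [Matrix.conjTranspose_apply]
  · have h : (0 : ℂ) ≤ inner ℂ (x.sum fun a c => c • v a) (x.sum fun a c => c • v a) := by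
      rw [inner_self_eq_norm_sq_to_K, ← RCLike.ofReal_pow]
      exact Complex.zero_le_real.2 (sq_nonneg _)
    refine h.trans_eq ?_
    simp only [Finsupp.sum, sum_inner, inner_sum, inner_smul_left, inner_smul_right,
      Matrix.of_apply, Finset.mul_sum]
    rw [Finset.sum_comm]
    refine Finset.sum_congr rfl fun a _ => Finset.sum_congr rfl fun b _ => ?_
    rw [starRingEnd_apply]
    ring

theorem posSemidef_prod {ι κ : Type*} (s : Finset κ) (M : κ → Matrix ι ι ℂ)
    (h : ∀ k ∈ s, (M k).PosSemidef) :
    (Matrix.of fun a b => ∏ k ∈ s, M k a b).PosSemidef := by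
  classical
  induction s using Finset.induction_on with
  | empty =>
    simpa using posSemidef_inner (fun _ : ι => (1 : ℂ))
  | insert k s hk ih =>
    have e : (Matrix.of fun a b => ∏ l ∈ insert k s, M l a b) =
        (M k).hadamard (Matrix.of fun a b => ∏ l ∈ s, M l a b) := by
      ext a b
      simp [Finset.prod_insert hk]
    rw [e]
    exact Matrix.PosSemidef.hadamard (h k (Finset.mem_insert_self k s))
      (ih fun l hl => h l (Finset.mem_insert_of_mem hl))

theorem posSemidef_sum_snd {α β : Type*} [Fintype β] (M : Matrix (α × β) (α × β) ℂ)
    (h : M.PosSemidef) :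
    (Matrix.of fun a b => ∑ s : β, ∑ t : β, M (a, s) (b, t)).PosSemidef := by
  classical
  refine ⟨?_, fun x => ?_⟩
  · ext a b
    simp only [Matrix.conjTranspose_apply, Matrix.of_apply, star_sum]
    rw [Finset.sum_comm]
    refine Finset.sum_congr rfl fun s _ => Finset.sum_congr rfl fun t _ => h.1.apply _ _
  · set y : α × β →₀ ℂ := Finsupp.onFinset (x.support ×ˢ Finset.univ) (fun p => x p.1)
      (fun p hp => by simpa using hp) with hy
    have hs : ∀ g : α × β → ℂ → ℂ, (∀ p, g p 0 = 0) →
        y.sum g = ∑ a ∈ x.support, ∑ s : β, g (a, s) (x a) := by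
      intro g hg
      rw [hy, Finsupp.onFinset_sum _ hg, Finset.sum_product]
    have := h.2 y
    rw [hs _ (by simp)] at this
    refine this.trans_eq ?_
    refine Finset.sum_congr rfl fun a _ => ?_
    refine (Finset.sum_congr rfl fun s _ =>
      hs (fun j xj => star (x a) * M (a, s) j * xj) (by simp)).trans ?_
    rw [Finset.sum_comm]
    refine Finset.sum_congr rfl fun b _ => ?_
    simp only [Matrix.of_apply, Finset.mul_sum, Finset.sum_mul]

theorem posSemidef_sign {ι : Type*} (q : ℝ) (hq : |q| ≤ 1) (s : ι → Prop) [DecidablePred s] :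
    (Matrix.of fun a b => if (s a ↔ s b) then (1 : ℂ) else (q : ℂ)).PosSemidef := by
  obtain ⟨h1, h2⟩ := abs_le.1 hq
  have e1 := (posSemidef_inner (fun _ : ι => (1 : ℂ))).smul
    (show (0 : ℝ) ≤ (1 + q) / 2 by linarith)
  have e2 := (posSemidef_inner (fun a : ι => if s a then (1 : ℂ) else -1)).smul
    (show (0 : ℝ) ≤ (1 - q) / 2 by linarith)
  convert e1.add e2 using 1
  ext a b
  by_cases ha : s a <;> by_cases hb : s b <;> simp [ha, hb] <;> ring

theorem pow_inversions (q : ℝ) {n : ℕ} (σ τ : Equiv.Perm (Fin n)) :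
    (q : ℂ) ^ inversions (τ * σ⁻¹) = ∏ p ∈ Finset.univ.filter
      (fun p : Fin n × Fin n => p.1 < p.2),
      if (σ p.1 < σ p.2 ↔ τ p.1 < τ p.2) then (1 : ℂ) else (q : ℂ) := by
  rw [Finset.prod_ite, Finset.prod_const_one, one_mul, Finset.prod_const]
  congr 1
  unfold inversions
  symm
  refine Finset.card_bij' (fun p _ => if σ p.1 < σ p.2 then (σ p.1, σ p.2) else (σ p.2, σ p.1))
    (fun p _ => if σ.symm p.1 < σ.symm p.2 then (σ.symm p.1, σ.symm p.2)
      else (σ.symm p.2, σ.symm p.1))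
    ?_ ?_ ?_ ?_
  · rintro ⟨a, b⟩ h
    have e1 : a ≠ b → σ a ≠ σ b := fun h h' => h (σ.injective h')
    have e2 : a ≠ b → τ a ≠ τ b := fun h h' => h (τ.injective h')
    simp only [Finset.mem_filter, Finset.mem_univ, true_and] at h ⊢
    split_ifs with h' <;> simp <;> grind
  · rintro ⟨a, b⟩ h
    have e1 : a ≠ b → σ.symm a ≠ σ.symm b := fun h h' => h (σ.symm.injective h')
    simp only [Finset.mem_filter, Finset.mem_univ, true_and, Equiv.Perm.mul_apply,
      Equiv.Perm.inv_def] at h ⊢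
    split_ifs with h' <;> simp <;> grind
  · rintro ⟨a, b⟩ h
    simp only [Finset.mem_filter, Finset.mem_univ, true_and] at h ⊢
    split_ifs <;> simp_all
    grind
  · rintro ⟨a, b⟩ h
    simp only [Finset.mem_filter, Finset.mem_univ, true_and] at h ⊢
    split_ifs <;> simp_all
    grind

theorem kernelDeg_posSemidef (q : ℝ) (hq : |q| ≤ 1) (n : ℕ) :
    (Matrix.of fun f g : Fin n → E => kernelDeg q f g).PosSemidef := by
  have hM : (Matrix.of fun x y : (Fin n → E) × Equiv.Perm (Fin n) =>
      (q : ℂ) ^ inversions (y.2 * x.2⁻¹) * ∏ k, inner ℂ (x.1 (x.2 k)) (y.1 (y.2 k))).PosSemidef := by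
    have h1 := posSemidef_prod (ι := (Fin n → E) × Equiv.Perm (Fin n))
      (Finset.univ.filter (fun p : Fin n × Fin n => p.1 < p.2)) _
      (fun p _ => posSemidef_sign q hq
        (fun x : (Fin n → E) × Equiv.Perm (Fin n) => x.2 p.1 < x.2 p.2))
    have h2 := posSemidef_prod (ι := (Fin n → E) × Equiv.Perm (Fin n)) Finset.univ _
      (fun k _ => posSemidef_inner
        (fun x : (Fin n → E) × Equiv.Perm (Fin n) => x.1 (x.2 k)))
    have e := Matrix.PosSemidef.hadamard h1 h2
    simp only [pow_inversions]
    exact e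
  have h := (posSemidef_sum_snd _ hM).smul
    (show (0 : ℝ) ≤ ((Fintype.card (Equiv.Perm (Fin n)) : ℝ))⁻¹ by positivity)
  convert h using 1
  ext f g
  simp only [Matrix.of_apply, Matrix.smul_apply]
  have : ∀ σ : Equiv.Perm (Fin n), ∑ τ : Equiv.Perm (Fin n),
      (q : ℂ) ^ inversions (τ * σ⁻¹) * ∏ k, inner ℂ (f (σ k)) (g (τ k)) = kernelDeg q f g := by
    intro σ
    unfold kernelDeg
    rw [← Equiv.sum_comp (Equiv.mulRight σ)]
    refine Finset.sum_congr rfl fun π _ => ?_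
    simp only [Equiv.coe_mulRight, mul_inv_cancel_right, Equiv.Perm.mul_apply]
    congr 1
    exact Equiv.prod_comp σ (fun k => inner ℂ (f k) (g (π k)))
  rw [Finset.sum_congr rfl fun σ _ => this σ, Finset.sum_const, Finset.card_univ, nsmul_eq_mul,
    Complex.real_smul, ← mul_assoc]
  push_cast
  rw [inv_mul_cancel₀, one_mul]
  exact_mod_cast Fintype.card_ne_zero

theorem kernel_nonneg (q : ℝ) (hq : |q| ≤ 1) (x : Simple E →₀ ℂ) :
    0 ≤ x.sum fun u a => x.sum fun v b => conj a * b * kernel q u v := by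
  rw [Finsupp.sigma_sum]
  refine Finset.sum_nonneg fun n hn => ?_
  refine ((kernelDeg_posSemidef (E := E) q hq n).2 (x.split n)).trans_eq ?_
  refine Finset.sum_congr rfl fun f _ => ?_
  dsimp only
  rw [Finsupp.sigma_sum, Finset.sum_eq_single_of_mem n hn]
  · refine Finset.sum_congr rfl fun g _ => ?_
    simp only [kernel_same, Matrix.of_apply]
    rw [mul_right_comm]
    rfl
  · intro m _ hm
    refine Finset.sum_eq_zero fun g _ => ?_
    simp [kernel_ne q (Ne.symm hm)]


end Kernel

/-- Expansion of the `q`-inner product along the position of `π(1)`. -/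
theorem kernelDeg_cons (q : ℝ) {E : Type*} [NormedAddCommGroup E] [InnerProductSpace ℂ E] {n : ℕ}
    (f : E) (g : Fin n → E) (h : Fin (n + 1) → E) :
    kernelDeg q (Fin.cons f g : Fin (n + 1) → E) h =
      ∑ k : Fin (n + 1), (q : ℂ) ^ (k : ℕ) * inner ℂ f (h k) *
        kernelDeg q g (fun l => h (k.succAbove l)) := by
  classical
  let F : Fin (n + 1) × Equiv.Perm (Fin n) → Equiv.Perm (Fin (n + 1)) := fun p =>
    Equiv.ofBijective (Fin.cons p.1 (fun l => p.1.succAbove (p.2 l)) : Fin (n + 1) → Fin (n + 1))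
      (Finite.injective_iff_bijective.1 (by
        rw [Fin.cons_injective_iff]
        refine ⟨?_, Fin.succAbove_right_injective.comp p.2.injective⟩
        rintro ⟨l, hl⟩
        exact Fin.succAbove_ne _ _ hl))
  have F0 : ∀ p, F p 0 = p.1 := fun p => rfl
  have Fs : ∀ p l, F p (Fin.succ l) = p.1.succAbove (p.2 l) := fun p l => rfl
  have hF : Function.Bijective F := by
    rw [Fintype.bijective_iff_injective_and_card]
    refine ⟨?_, ?_⟩
    · intro p p' h
      have h0 : p.1 = p'.1 := by rw [← F0 p, ← F0 p', h]
      refine Prod.ext h0 (Equiv.ext fun l => ?_)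
      have hl : F p l.succ = F p' l.succ := by rw [h]
      rw [Fs, Fs, h0] at hl
      exact Fin.succAbove_right_injective hl
    · simp [Fintype.card_perm, Nat.factorial_succ]
  have hinv : ∀ p, inversions (F p) = (p.1 : ℕ) + inversions p.2 := by
    intro p
    unfold inversions
    simp only [Finset.card_filter, Fintype.sum_prod_type, Fin.sum_univ_succ, F0, Fs,
      false_and, if_false, zero_add, Fin.succ_pos, true_and, Fin.not_lt_zero,
      Fin.succ_lt_succ_iff, (Fin.strictMono_succAbove p.1).lt_iff_lt]
    congr 1
    rw [Equiv.sum_comp p.2 (fun l => if p.1.succAbove l < p.1 then 1 else 0)]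
    simp only [Fin.succAbove_lt_iff_castSucc_lt]
    rw [← Finset.card_filter]
    have hk : ∀ l : Fin n, l.castSucc < p.1 ↔ (l : ℕ) < (p.1 : ℕ) := fun l => Iff.rfl
    simp only [hk]
    rw [Fin.card_filter_val_lt]
    exact min_eq_right (Nat.lt_succ_iff.1 p.1.2)
  unfold kernelDeg
  rw [← Equiv.sum_comp (Equiv.ofBijective F hF), Fintype.sum_prod_type]
  refine Finset.sum_congr rfl fun k _ => ?_
  rw [Finset.mul_sum]
  refine Finset.sum_congr rfl fun ρ _ => ?_
  simp only [Equiv.ofBijective_apply, hinv, Fin.prod_univ_succ, F0, Fs, Fin.cons_zero,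
    Fin.cons_succ, pow_add]
  ring

section PreFock

variable {E : Type*}

/-- The linear span of the simple tensors, before relations: formal finite linear combinations of
the symbols `f₁ ⊗ ⋯ ⊗ fₙ`, `n ≥ 0`. The relations of the algebraic tensor products hold modulo
null vectors of the `q`-inner product and therefore in the (separated) completion. -/
def PreFock (_q : Set.Ioo (-1 : ℝ) 1) (E : Type*) : Type _ := Simple E →₀ ℂ

variable {q : Set.Ioo (-1 : ℝ) 1}

instance : AddCommGroup (PreFock q E) := inferInstanceAs (AddCommGroup (Simple E →₀ ℂ))

instance : Module ℂ (PreFock q E) := inferInstanceAs (Module ℂ (Simple E →₀ ℂ))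

namespace PreFock

/-- The simple tensor `u` as a vector. -/
def tensor (q : Set.Ioo (-1 : ℝ) 1) (u : Simple E) : PreFock q E := Finsupp.single u (1 : ℂ)

/-- The linear map with given values on the simple tensors. -/
def lift {M : Type*} [AddCommGroup M] [Module ℂ M] (φ : Simple E → M) : PreFock q E →ₗ[ℂ] M :=
  Finsupp.linearCombination ℂ φ

@[simp]
theorem lift_tensor {M : Type*} [AddCommGroup M] [Module ℂ M] (φ : Simple E → M) (u : Simple E) :
    lift φ (tensor q u) = φ u := by
  exact (Finsupp.linearCombination_single ℂ (1 : ℂ) u).trans (one_smul ℂ _)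

theorem induction {p : PreFock q E → Prop} (h0 : p 0) (hadd : ∀ x y, p x → p y → p (x + y))
    (hsmul : ∀ (c : ℂ) x, p x → p (c • x)) (ht : ∀ u, p (tensor q u)) (x : PreFock q E) : p x := by
  refine Finsupp.induction_linear (motive := p) x h0 hadd fun u a => ?_
  have : (Finsupp.single u a : Simple E →₀ ℂ) = a • (Finsupp.single u (1 : ℂ)) := by simp
  rw [this]
  exact hsmul a _ (ht u)

variable [NormedAddCommGroup E] [InnerProductSpace ℂ E]

/-- The sesquilinear extension of the `q`-inner product. -/
def form (x y : PreFock q E) : ℂ :=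
  Finsupp.sum x fun u a => Finsupp.sum y fun v b => conj a * b * kernel (q : ℝ) u v

theorem abs_le_one (q : Set.Ioo (-1 : ℝ) 1) : |(q : ℝ)| ≤ 1 := (abs_lt.2 q.2).le

/-- The `q`-inner product on the span of the simple tensors. -/
abbrev core (q : Set.Ioo (-1 : ℝ) 1) (E : Type*) [NormedAddCommGroup E] [InnerProductSpace ℂ E] :
    PreInnerProductSpace.Core ℂ (PreFock q E) where
  inner := form
  conj_inner_symm x y := by
    unfold form
    simp only [Finsupp.sum, map_sum, map_mul, kernel_conj, Complex.conj_conj]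
    rw [Finset.sum_comm]
    refine Finset.sum_congr rfl fun a _ => Finset.sum_congr rfl fun b _ => ?_
    ring
  re_inner_nonneg x :=
    (RCLike.nonneg_iff.1 (kernel_nonneg (q : ℝ) (abs_le_one q) x)).1
  add_left x y z := by
    unfold form
    refine Finsupp.sum_add_index' (fun u => by simp [Finsupp.sum]) fun u a b => ?_
    simp [Finsupp.sum, add_mul, Finset.sum_add_distrib]
  smul_left x y r := by
    unfold form
    refine (Finsupp.sum_smul_index' (b := r) (fun u => by simp [Finsupp.sum])).trans ?_
    simp [Finsupp.sum, Finset.mul_sum, mul_assoc]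

instance : SeminormedAddCommGroup (PreFock q E) :=
  @InnerProductSpace.Core.toSeminormedAddCommGroup ℂ _ _ _ _ (core q E)

instance : InnerProductSpace ℂ (PreFock q E) := InnerProductSpace.ofCore (core q E)

@[simp]
theorem inner_tensor (u v : Simple E) :
    inner ℂ (tensor q u) (tensor q v) = kernel (q : ℝ) u v := by
  change form (tensor q u) (tensor q v) = _
  unfold form tensor
  rw [Finsupp.sum_single_index, Finsupp.sum_single_index] <;> simp [Finsupp.sum]

/-- `f₁ ⊗ ⋯ ⊗ fₙ ↦ f ⊗ f₁ ⊗ ⋯ ⊗ fₙ`. -/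
def creator (f : E) : PreFock q E →ₗ[ℂ] PreFock q E :=
  lift fun u => tensor q ⟨u.1 + 1, Fin.cons f u.2⟩

/-- `Ω ↦ 0` and `f₁ ⊗ ⋯ ⊗ fₙ ↦ ∑ k, q ^ (k - 1) ⟨f, f_k⟩ f₁ ⊗ ⋯ f_{k-1} ⊗ f_{k+1} ⊗ ⋯ ⊗ fₙ`. -/
def annihilator (f : E) : PreFock q E →ₗ[ℂ] PreFock q E :=
  lift fun u => match u with
    | ⟨0, _⟩ => 0
    | ⟨n + 1, g⟩ => ∑ k : Fin (n + 1), (((q : ℝ) : ℂ) ^ (k : ℕ) * inner ℂ f (g k)) •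
        tensor q ⟨n, fun l => g (k.succAbove l)⟩

theorem inner_creator_left (f : E) (x y : PreFock q E) :
    inner ℂ (creator f x) y = inner ℂ x (annihilator f y) := by
  induction x using induction with
  | h0 => simp
  | hadd x x' hx hx' => simp [inner_add_left, hx, hx']
  | hsmul c x hx => simp [inner_smul_left, hx]
  | ht u =>
    induction y using induction with
    | h0 => simp
    | hadd x x' hx hx' => simp only [map_add, inner_add_right, hx, hx']
    | hsmul c x hx => simp only [map_smul, inner_smul_right, hx]
    | ht v =>
      obtain ⟨n, g⟩ := u
      obtain ⟨m, h⟩ := v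
      cases m with
      | zero => simp [creator, annihilator, kernel_ne]
      | succ m =>
        simp only [creator, annihilator, lift_tensor, inner_tensor, inner_sum, inner_smul_right]
        by_cases hnm : n = m
        · subst hnm
          simp only [kernel_same, kernelDeg_cons]
        · simp [kernel_ne (q : ℝ) hnm, kernel_ne (q : ℝ) (fun h => hnm (Nat.succ.inj h))]

/-- The `q`-commutation relation `a(f) a⁺(g) - q a⁺(g) a(f) = ⟨f, g⟩ 1`. -/
theorem annihilator_creator (f g : E) (x : PreFock q E) :
    annihilator f (creator g x) =
      (inner ℂ f g : ℂ) • x + ((q : ℝ) : ℂ) • creator g (annihilator f x) := by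
  induction x using induction with
  | h0 => simp
  | hadd x x' hx hx' => simp only [map_add, hx, hx', smul_add]; abel
  | hsmul c x hx =>
    simp only [map_smul, hx, smul_add, smul_smul]
    rw [mul_comm c, mul_comm c]
  | ht u =>
    obtain ⟨n, h⟩ := u
    cases n with
    | zero =>
      simp only [creator, annihilator, lift_tensor, map_zero, smul_zero, add_zero]
      rw [Fin.sum_univ_succ]
      simp
    | succ n =>
      simp only [creator, annihilator, lift_tensor, map_sum, map_smul]
      rw [Fin.sum_univ_succ]
      congr 1
      · simp
      · rw [Finset.smul_sum]
        refine Finset.sum_congr rfl fun k _ => ?_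
        rw [smul_smul]
        congr 1
        · simp [pow_succ]; ring
        · congr 2
          funext l
          refine Fin.cases ?_ (fun l => ?_) l <;> simp

theorem norm_creator_sq (f : E) (x : PreFock q E) :
    ‖creator f x‖ ^ 2 = ‖f‖ ^ 2 * ‖x‖ ^ 2 + (q : ℝ) * ‖annihilator f x‖ ^ 2 := by
  have h : (inner ℂ (creator f x) (creator f x) : ℂ) =
      inner ℂ f f * inner ℂ x x + (q : ℝ) * inner ℂ (annihilator f x) (annihilator f x) := by
    rw [inner_creator_left, annihilator_creator, inner_add_right, inner_smul_right,
      inner_smul_right, ← inner_conj_symm x (creator f _), inner_creator_left, inner_conj_symm]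
  simp only [inner_self_eq_norm_sq_to_K] at h
  apply Complex.ofReal_injective
  push_cast
  exact h

theorem norm_creator_sq_le_aux (f : E) (N : ℕ) (x : PreFock q E)
    (hx : x ∈ Submodule.span ℂ {y | ∃ u : Simple E, u.1 < N ∧ y = tensor q u}) :
    ‖creator f x‖ ^ 2 ≤ ‖f‖ ^ 2 / (1 - |(q : ℝ)|) * ‖x‖ ^ 2 := by
  have hq : 0 < 1 - |(q : ℝ)| := sub_pos.2 (abs_lt.2 q.2)
  set c := ‖f‖ ^ 2 / (1 - |(q : ℝ)|) with hc
  have hc0 : 0 ≤ c := by positivity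
  have hcf : c = ‖f‖ ^ 2 + |(q : ℝ)| * c := by
    rw [hc]; field_simp; ring
  induction N generalizing x with
  | zero =>
    have : x = 0 := by simpa using hx
    simp [this]
  | succ N ih =>
    have hmem : annihilator f x ∈
        Submodule.span ℂ {y | ∃ u : Simple E, u.1 < N ∧ y = tensor q u} := by
      induction hx using Submodule.span_induction with
      | zero => simp
      | add x y _ _ hx hy => rw [map_add]; exact add_mem hx hy
      | smul a x _ hx => rw [map_smul]; exact Submodule.smul_mem _ a hx
      | mem x hx =>
        obtain ⟨⟨n, g⟩, hu, rfl⟩ := hx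
        cases n with
        | zero => simp [annihilator]
        | succ n =>
          simp only [annihilator, lift_tensor]
          refine Submodule.sum_mem _ fun k _ => Submodule.smul_mem _ _ (Submodule.subset_span ?_)
          exact ⟨_, Nat.lt_of_succ_lt_succ hu, rfl⟩
    have h1 := ih _ hmem
    have h2 : ‖annihilator f x‖ ^ 2 ≤ ‖creator f (annihilator f x)‖ * ‖x‖ := by
      have e : (inner ℂ (annihilator f x) (annihilator f x) : ℂ) =
          inner ℂ (creator f (annihilator f x)) x := (inner_creator_left _ _ _).symm
      have := norm_inner_le_norm (𝕜 := ℂ) (creator f (annihilator f x)) x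
      rw [← e, inner_self_eq_norm_sq_to_K] at this
      simpa using this
    have h3 : ‖annihilator f x‖ ^ 2 ≤ c * ‖x‖ ^ 2 := by
      set A := ‖annihilator f x‖
      set B := ‖creator f (annihilator f x)‖
      have hA : 0 ≤ A := norm_nonneg _
      have hB : 0 ≤ B := norm_nonneg _
      have h4 : (A ^ 2) ^ 2 ≤ c * A ^ 2 * ‖x‖ ^ 2 := by
        calc (A ^ 2) ^ 2 ≤ (B * ‖x‖) ^ 2 := by gcongr
          _ = B ^ 2 * ‖x‖ ^ 2 := by ring
          _ ≤ c * A ^ 2 * ‖x‖ ^ 2 := by gcongr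
      rcases hA.eq_or_lt with h | h
      · rw [← h, zero_pow two_ne_zero]; positivity
      · have : 0 < A ^ 2 := by positivity
        nlinarith
    rw [norm_creator_sq]
    have h5 : (q : ℝ) * ‖annihilator f x‖ ^ 2 ≤ |(q : ℝ)| * (c * ‖x‖ ^ 2) :=
      (mul_le_mul_of_nonneg_right (le_abs_self _) (sq_nonneg _)).trans
        (mul_le_mul_of_nonneg_left h3 (abs_nonneg _))
    calc _ ≤ ‖f‖ ^ 2 * ‖x‖ ^ 2 + |(q : ℝ)| * (c * ‖x‖ ^ 2) := by gcongr
      _ = (‖f‖ ^ 2 + |(q : ℝ)| * c) * ‖x‖ ^ 2 := by ring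
      _ = c * ‖x‖ ^ 2 := by rw [← hcf]

theorem norm_creator_le (f : E) (x : PreFock q E) :
    ‖creator f x‖ ≤ √(‖f‖ ^ 2 / (1 - |(q : ℝ)|)) * ‖x‖ := by
  have hq : 0 < 1 - |(q : ℝ)| := sub_pos.2 (abs_lt.2 q.2)
  have hx : ∃ N : ℕ, x ∈ Submodule.span ℂ {y | ∃ u : Simple E, u.1 < N ∧ y = tensor q u} := by
    have mono : ∀ N M : ℕ, N ≤ M →
        Submodule.span ℂ {y | ∃ u : Simple E, u.1 < N ∧ y = tensor q u} ≤
        Submodule.span ℂ {y | ∃ u : Simple E, u.1 < M ∧ y = tensor q u} := fun N M h =>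
      Submodule.span_mono fun y ⟨u, hu, hy⟩ => ⟨u, hu.trans_le h, hy⟩
    induction x using induction with
    | h0 => exact ⟨0, zero_mem _⟩
    | hadd x y hx hy =>
      obtain ⟨N, hN⟩ := hx
      obtain ⟨M, hM⟩ := hy
      exact ⟨max N M, add_mem (mono _ _ (le_max_left _ _) hN) (mono _ _ (le_max_right _ _) hM)⟩
    | hsmul c x hx =>
      obtain ⟨N, hN⟩ := hx
      exact ⟨N, Submodule.smul_mem _ _ hN⟩
    | ht u => exact ⟨u.1 + 1, Submodule.subset_span ⟨u, Nat.lt_succ_self _, rfl⟩⟩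
  obtain ⟨N, hN⟩ := hx
  refine (pow_le_pow_iff_left₀ (norm_nonneg _) (mul_nonneg (Real.sqrt_nonneg _) (norm_nonneg _)) two_ne_zero).1 ?_
  rw [mul_pow, Real.sq_sqrt (div_nonneg (sq_nonneg _) hq.le)]
  exact norm_creator_sq_le_aux f N x hN

end PreFock

end PreFock

section Fock

variable (q : Set.Ioo (-1 : ℝ) 1) {E : Type*} [NormedAddCommGroup E] [InnerProductSpace ℂ E]

/-- The `q`-deformed Fock space over `E`: the completion of the span of the simple tensors. -/
abbrev Fock (E : Type*) [NormedAddCommGroup E] [InnerProductSpace ℂ E] : Type _ :=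
  UniformSpace.Completion (PreFock q E)

/-- The vector `f₁ ⊗ ⋯ ⊗ fₙ` of the Fock space. -/
def tensor {n : ℕ} (f : Fin n → E) : Fock q E :=
  ((PreFock.tensor q ⟨n, f⟩ : PreFock q E) : UniformSpace.Completion (PreFock q E))

/-- The vacuum vector. -/
def vacuum (E : Type*) [NormedAddCommGroup E] [InnerProductSpace ℂ E] : Fock q E :=
  tensor q (Fin.elim0 : Fin 0 → E)

/-- The creator `a⁺(f)` on the Fock space. -/
def creator (f : E) : Fock q E →L[ℂ] Fock q E :=
  ((PreFock.creator f).mkContinuous (√(‖f‖ ^ 2 / (1 - |(q : ℝ)|)))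
    (PreFock.norm_creator_le f)).completion

/-- The annihilator `a(f)`, the adjoint of the creator. -/
def annihilator (f : E) : Fock q E →L[ℂ] Fock q E :=
  ContinuousLinearMap.adjoint (creator q f)

theorem creator_coe (f : E) (x : PreFock q E) :
    creator q f (x : Fock q E) = (PreFock.creator f x : PreFock q E) :=
  ContinuousLinearMap.completion_apply_coe _ _

/-- The inner product of simple tensors. -/
theorem inner_tensor {n : ℕ} (f g : Fin n → E) :
    inner ℂ (tensor q f) (tensor q g) = ∑ π : Equiv.Perm (Fin n),
      (((q : ℝ) : ℂ) ^ inversions π * ∏ k, inner ℂ (f k) (g (π k)) : ℂ) := by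
  unfold tensor
  rw [UniformSpace.Completion.inner_coe, PreFock.inner_tensor, kernel_same]
  rfl

theorem inner_tensor_of_ne {n m : ℕ} (h : n ≠ m) (f : Fin n → E) (g : Fin m → E) :
    (inner ℂ (tensor q f) (tensor q g) : ℂ) = 0 := by
  unfold tensor
  rw [UniformSpace.Completion.inner_coe, PreFock.inner_tensor, kernel_ne _ h]

theorem dense_tensor :
    Dense (Submodule.span ℂ {x : Fock q E | ∃ (n : ℕ) (f : Fin n → E), x = tensor q f} :
      Set (Fock q E)) := by
  refine UniformSpace.Completion.denseRange_coe.mono ?_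
  rintro _ ⟨x, rfl⟩
  induction x using PreFock.induction with
  | h0 => exact zero_mem (Submodule.span ℂ _)
  | hadd x y hx hy =>
    rw [UniformSpace.Completion.coe_add]
    exact add_mem (S := Submodule ℂ (Fock q E)) hx hy
  | hsmul c x hx =>
    rw [UniformSpace.Completion.coe_smul]
    exact Submodule.smul_mem _ c hx
  | ht u => exact Submodule.subset_span ⟨u.1, u.2, rfl⟩

theorem ext_tensor {x y : Fock q E}
    (h : ∀ (n : ℕ) (f : Fin n → E), (inner ℂ (tensor q f) x : ℂ) = inner ℂ (tensor q f) y) :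
    x = y := by
  have h' : innerSL ℂ x = innerSL ℂ y := by
    refine ContinuousLinearMap.ext_on (dense_tensor q) ?_
    rintro _ ⟨n, f, rfl⟩
    rw [innerSL_apply_apply, innerSL_apply_apply, ← inner_conj_symm x, h, inner_conj_symm]
  exact ext_inner_right ℂ fun z => DFunLike.congr_fun h' z

theorem prod_inner_perm {n : ℕ} (π : Equiv.Perm (Fin n)) (f g : Fin n → E) :
    ∏ k, (inner ℂ (f k) (g (π k)) : ℂ) = ∏ l, inner ℂ (f (π.symm l)) (g l) := by
  rw [← Equiv.prod_comp π fun l => (inner ℂ (f (π.symm l)) (g l) : ℂ)]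
  simp

/-- In the Fock space the simple tensors are multilinear. -/
def tensorMultilinear (n : ℕ) : MultilinearMap ℂ (fun _ : Fin n => E) (Fock q E) where
  toFun := tensor q
  map_update_add' g i x y := by
    refine ext_tensor q fun m f => ?_
    rw [inner_add_right]
    by_cases h : n = m
    · subst h
      simp only [inner_tensor, ← Finset.sum_add_distrib, ← mul_add]
      refine Finset.sum_congr rfl fun π _ => ?_
      congr 1
      have := ((MultilinearMap.mkPiAlgebra ℂ (Fin n) ℂ).compLinearMap
        (fun j => (innerSL ℂ (f (π.symm j))).toLinearMap)).map_update_add g i x y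
      simp only [MultilinearMap.compLinearMap_apply, MultilinearMap.mkPiAlgebra_apply,
        ContinuousLinearMap.coe_coe, innerSL_apply_apply] at this
      simpa only [prod_inner_perm] using this
    · simp [inner_tensor_of_ne q (Ne.symm h)]
  map_update_smul' g i c x := by
    refine ext_tensor q fun m f => ?_
    rw [inner_smul_right]
    by_cases h : n = m
    · subst h
      simp only [inner_tensor, Finset.mul_sum]
      refine Finset.sum_congr rfl fun π _ => ?_
      rw [mul_left_comm]
      congr 1
      have := ((MultilinearMap.mkPiAlgebra ℂ (Fin n) ℂ).compLinearMap
        (fun j => (innerSL ℂ (f (π.symm j))).toLinearMap)).map_update_smul g i c x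
      simp only [MultilinearMap.compLinearMap_apply, MultilinearMap.mkPiAlgebra_apply,
        ContinuousLinearMap.coe_coe, innerSL_apply_apply, smul_eq_mul] at this
      simpa only [prod_inner_perm] using this
    · simp [inner_tensor_of_ne q (Ne.symm h)]

theorem creator_tensor (f : E) {n : ℕ} (g : Fin n → E) :
    creator q f (tensor q g) = tensor q (Fin.cons f g : Fin (n + 1) → E) := by
  unfold tensor
  rw [creator_coe]
  simp [PreFock.creator]

theorem annihilator_coe (f : E) (x : PreFock q E) :
    annihilator q f (x : Fock q E) = (PreFock.annihilator f x : PreFock q E) := by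
  refine ext_inner_left ℂ fun y => ?_
  rw [annihilator, ContinuousLinearMap.adjoint_inner_right]
  induction y using UniformSpace.Completion.induction_on with
  | hp => exact isClosed_eq (by fun_prop) (by fun_prop)
  | ih y =>
    rw [creator_coe, UniformSpace.Completion.inner_coe, UniformSpace.Completion.inner_coe,
      PreFock.inner_creator_left]

theorem annihilator_vacuum (f : E) : annihilator q f (vacuum q E) = 0 := by
  unfold vacuum tensor
  rw [annihilator_coe]
  simp only [PreFock.annihilator, PreFock.lift_tensor]
  exact UniformSpace.Completion.coe_zero

theorem annihilator_tensor (f : E) {n : ℕ} (g : Fin (n + 1) → E) :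
    annihilator q f (tensor q g) = ∑ k : Fin (n + 1),
      (((q : ℝ) : ℂ) ^ (k : ℕ) * inner ℂ f (g k) : ℂ) • tensor q (fun l => g (k.succAbove l)) := by
  unfold tensor
  rw [annihilator_coe]
  simp only [PreFock.annihilator, PreFock.lift_tensor]
  rw [← UniformSpace.Completion.coe_toComplL (𝕜 := ℂ), map_sum]
  simp

theorem PreFock.inner_map (u : E →ₗᵢ[ℂ] E) (x y : PreFock q E) :
    inner ℂ (PreFock.lift (fun s => PreFock.tensor q ⟨s.1, u ∘ s.2⟩) x)
      (PreFock.lift (fun s => PreFock.tensor q ⟨s.1, u ∘ s.2⟩) y) = (inner ℂ x y : ℂ) := by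
  induction x using PreFock.induction with
  | h0 => simp
  | hadd x x' hx hx' => simp [inner_add_left, hx, hx']
  | hsmul c x hx => simp [inner_smul_left, hx]
  | ht s =>
    induction y using PreFock.induction with
    | h0 => simp
    | hadd x x' hx hx' => simp only [map_add, inner_add_right, hx, hx']
    | hsmul c x hx => simp only [map_smul, inner_smul_right, hx]
    | ht t =>
      simp only [PreFock.lift_tensor, PreFock.inner_tensor]
      obtain ⟨n, f⟩ := s
      obtain ⟨m, g⟩ := t
      by_cases h : n = m
      · subst h
        simp [kernel_same, kernelDeg]
      · simp [kernel_ne _ h]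

/-- `f₁ ⊗ ⋯ ⊗ fₙ ↦ u f₁ ⊗ ⋯ ⊗ u fₙ` on the span of the simple tensors. -/
def PreFock.map (u : E →ₗᵢ[ℂ] E) : PreFock q E →ₗᵢ[ℂ] PreFock q E where
  toLinearMap := PreFock.lift fun s => PreFock.tensor q ⟨s.1, u ∘ s.2⟩
  norm_map' x := by
    rw [norm_eq_sqrt_re_inner (𝕜 := ℂ), PreFock.inner_map, ← norm_eq_sqrt_re_inner]

theorem PreFock.map_map (u v : E →ₗᵢ[ℂ] E) (h : ∀ x, u (v x) = x) (x : PreFock q E) :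
    PreFock.map q u (PreFock.map q v x) = x := by
  induction x using PreFock.induction with
  | h0 => simp
  | hadd x y hx hy => simp [hx, hy]
  | hsmul c x hx => simp [hx]
  | ht s =>
    change PreFock.lift _ (PreFock.lift _ _) = _
    rw [PreFock.lift_tensor, PreFock.lift_tensor]
    congr 1
    exact Sigma.ext rfl (heq_of_eq (funext fun k => h _))

/-- The second quantization of an isometry `u`: `Ω ↦ Ω`,
`f₁ ⊗ ⋯ ⊗ fₙ ↦ u f₁ ⊗ ⋯ ⊗ u fₙ`. -/
def mapIsometry (u : E →ₗᵢ[ℂ] E) : Fock q E →ₗᵢ[ℂ] Fock q E where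
  toLinearMap := ((PreFock.map q u).toContinuousLinearMap.completion : Fock q E →L[ℂ] Fock q E)
  norm_map' x := by
    induction x using UniformSpace.Completion.induction_on with
    | hp =>
      exact isClosed_eq (((PreFock.map q u).toContinuousLinearMap.completion :
          Fock q E →L[ℂ] Fock q E).continuous.norm) continuous_norm
    | ih x =>
      change ‖((PreFock.map q u).toContinuousLinearMap.completion : Fock q E →L[ℂ] Fock q E)
        (x : Fock q E)‖ = _
      rw [ContinuousLinearMap.completion_apply_coe, UniformSpace.Completion.norm_coe,
        UniformSpace.Completion.norm_coe]
      exact (PreFock.map q u).norm_map x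

theorem mapIsometry_coe (u : E →ₗᵢ[ℂ] E) (x : PreFock q E) :
    mapIsometry q u (x : Fock q E) = (PreFock.map q u x : PreFock q E) :=
  ContinuousLinearMap.completion_apply_coe _ _

theorem mapIsometry_mapIsometry (u v : E →ₗᵢ[ℂ] E) (h : ∀ x, u (v x) = x) (x : Fock q E) :
    mapIsometry q u (mapIsometry q v x) = x := by
  induction x using UniformSpace.Completion.induction_on with
  | hp =>
    exact isClosed_eq ((mapIsometry q u).continuous.comp (mapIsometry q v).continuous) continuous_id
  | ih x => rw [mapIsometry_coe, mapIsometry_coe, PreFock.map_map q u v h]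

/-- The second quantization of a unitary, as a unitary of the Fock space. -/
def secondQuantization (u : E ≃ₗᵢ[ℂ] E) : Fock q E ≃ₗᵢ[ℂ] Fock q E :=
  LinearIsometryEquiv.ofLinearIsometry (mapIsometry q u.toLinearIsometry)
    (mapIsometry q u.symm.toLinearIsometry).toLinearMap
    (LinearMap.ext fun x => mapIsometry_mapIsometry q _ _ (fun y => u.apply_symm_apply y) x)
    (LinearMap.ext fun x => mapIsometry_mapIsometry q _ _ (fun y => u.symm_apply_apply y) x)

theorem secondQuantization_coe (u : E ≃ₗᵢ[ℂ] E) (x : PreFock q E) :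
    secondQuantization q u (x : Fock q E) = (PreFock.map q u.toLinearIsometry x : PreFock q E) :=
  mapIsometry_coe q _ x

theorem secondQuantization_tensor (u : E ≃ₗᵢ[ℂ] E) {n : ℕ} (f : Fin n → E) :
    secondQuantization q u (tensor q f) = tensor q (fun k => u (f k)) := by
  unfold tensor
  rw [secondQuantization_coe]
  congr 1
  exact PreFock.lift_tensor _ _

theorem secondQuantization_creator (u : E ≃ₗᵢ[ℂ] E) (f : E) (x : Fock q E) :
    secondQuantization q u (creator q f x) = creator q (u f) (secondQuantization q u x) := by
  induction x using UniformSpace.Completion.induction_on with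
  | hp =>
    exact isClosed_eq ((secondQuantization q u).continuous.comp (creator q f).continuous)
      ((creator q (u f)).continuous.comp (secondQuantization q u).continuous)
  | ih x =>
    rw [creator_coe, secondQuantization_coe, secondQuantization_coe, creator_coe]
    congr 1
    induction x using PreFock.induction with
    | h0 => simp
    | hadd x y hx hy => simp [hx, hy]
    | hsmul c x hx => simp [hx]
    | ht s =>
      change PreFock.lift _ (PreFock.lift _ _) = PreFock.lift _ (PreFock.lift _ _)
      simp only [PreFock.lift_tensor]
      congr 1
      refine Sigma.ext rfl (heq_of_eq (funext fun k => ?_))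
      refine Fin.cases ?_ (fun l => ?_) k <;> simp

theorem conj_creator (u : E ≃ₗᵢ[ℂ] E) (f : E) :
    (secondQuantization q u).conjStarAlgEquiv (creator q f) = creator q (u f) := by
  ext x
  rw [LinearIsometryEquiv.conjStarAlgEquiv_apply_apply, secondQuantization_creator,
    LinearIsometryEquiv.apply_symm_apply]

theorem conj_annihilator (u : E ≃ₗᵢ[ℂ] E) (f : E) :
    (secondQuantization q u).conjStarAlgEquiv (annihilator q f) = annihilator q (u f) := by
  unfold annihilator
  rw [← ContinuousLinearMap.star_eq_adjoint, ← ContinuousLinearMap.star_eq_adjoint,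
    ← conj_creator]
  exact (secondQuantization q u).conjStarAlgEquiv.map_star' _

end Fock

section Shift

/-- The one-particle space `ℓ²(ℤ)`. -/
abbrev H : Type := lp (fun _ : ℤ => ℂ) 2

/-- The canonical basis of `ℓ²(ℤ)`. -/
def stdBasis (i : ℤ) : H := lp.single 2 i (1 : ℂ)

/-- Translation `(f_i)_i ↦ (f_{i - m})_i` on `ℓ²(ℤ)`. -/
def translate (m : ℤ) (f : H) : H :=
  ⟨fun i => f (i - m), by
    have h := lp.memℓp f
    change Memℓp (fun i => f (i - m)) 2
    rw [memℓp_gen_iff (by norm_num)] at h ⊢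
    exact (Equiv.subRight m).summable_iff.2 h⟩

theorem norm_translate (m : ℤ) (f : H) : ‖translate m f‖ = ‖f‖ := by
  rw [lp.norm_eq_tsum_rpow (by norm_num), lp.norm_eq_tsum_rpow (by norm_num)]
  congr 1
  exact (Equiv.subRight m).tsum_eq (fun i => ‖f i‖ ^ (2 : ENNReal).toReal)

/-- The bilateral shift of `ℓ²(ℤ)`, which sends `e_i` to `e_{i+1}`. -/
def bilateralShift : H ≃ₗᵢ[ℂ] H where
  toFun := translate 1
  invFun := translate (-1)
  left_inv f := by ext i; simp [translate]
  right_inv f := by ext i; simp [translate]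
  map_add' f g := by ext i; rfl
  map_smul' c f := by ext i; rfl
  norm_map' f := norm_translate 1 f

theorem bilateralShift_stdBasis (i : ℤ) : bilateralShift (stdBasis i) = stdBasis (i + 1) := by
  ext j
  change (stdBasis i) (j - 1) = (stdBasis (i + 1)) j
  simp only [stdBasis, lp.single_apply, Pi.single_apply, sub_eq_iff_eq_add]

variable (q : Set.Ioo (-1 : ℝ) 1)

/-- The unital `C*`-algebra `R_q` generated by the annihilators `a_i = a(e_i)`, `i ∈ ℤ`. -/
def R : StarSubalgebra ℂ (Fock q H →L[ℂ] Fock q H) :=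
  (StarAlgebra.adjoin ℂ (Set.range fun i : ℤ => annihilator q (stdBasis i))).topologicalClosure

theorem annihilator_mem (i : ℤ) : annihilator q (stdBasis i) ∈ R q :=
  StarSubalgebra.le_topologicalClosure _ (StarAlgebra.subset_adjoin ℂ _ ⟨i, rfl⟩)

theorem creator_mem (i : ℤ) : creator q (stdBasis i) ∈ R q := by
  have h := star_mem (annihilator_mem q i)
  rwa [annihilator, ContinuousLinearMap.star_eq_adjoint,
    ContinuousLinearMap.adjoint_adjoint] at h

/-- The annihilator `a_i` as an element of `R_q`. -/
def ann (i : ℤ) : R q := ⟨annihilator q (stdBasis i), annihilator_mem q i⟩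

/-- The creator `a_i⁺` as an element of `R_q`. -/
def cre (i : ℤ) : R q := ⟨creator q (stdBasis i), creator_mem q i⟩

theorem conj_mem (u : H ≃ₗᵢ[ℂ] H) (hu : ∀ i, ∃ j, u (stdBasis i) = stdBasis j)
    {x : Fock q H →L[ℂ] Fock q H} (hx : x ∈ R q) :
    (secondQuantization q u).conjStarAlgEquiv x ∈ R q := by
  have hcont : Continuous (secondQuantization q u).conjStarAlgEquiv.toStarAlgHom := by
    have e : ⇑(secondQuantization q u).conjStarAlgEquiv.toStarAlgHom =
        fun x : Fock q H →L[ℂ] Fock q H =>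
          (((secondQuantization q u).toContinuousLinearEquiv : Fock q H →L[ℂ] Fock q H).comp
            x).comp
              ((secondQuantization q u).symm.toContinuousLinearEquiv :
                Fock q H →L[ℂ] Fock q H) := by
      funext x
      ext y
      rfl
    rw [e]
    exact (continuous_const.clm_comp continuous_id).clm_comp continuous_const
  have h : R q ≤ (R q).comap (secondQuantization q u).conjStarAlgEquiv.toStarAlgHom := by
    refine StarSubalgebra.topologicalClosure_minimal ?_
      ((StarSubalgebra.isClosed_topologicalClosure _).preimage hcont)
    rw [StarAlgebra.adjoin_le_iff]
    rintro _ ⟨i, rfl⟩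
    obtain ⟨j, hj⟩ := hu i
    change (secondQuantization q u).conjStarAlgEquiv (annihilator q (stdBasis i)) ∈ R q
    rw [conj_annihilator, hj]
    exact annihilator_mem q j
  exact h hx

theorem bilateralShift_symm_stdBasis (i : ℤ) : bilateralShift.symm (stdBasis i) = stdBasis (i - 1) := by
  rw [LinearIsometryEquiv.symm_apply_eq, bilateralShift_stdBasis, sub_add_cancel]

/-- The endomorphism `x ↦ U x U*` of `R_q`, for the second quantization `U` of a unitary which
permutes the canonical basis. -/
def conjHom (u : H ≃ₗᵢ[ℂ] H) (hu : ∀ i, ∃ j, u (stdBasis i) = stdBasis j) : R q →⋆ₐ[ℂ] R q :=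
  ((secondQuantization q u).conjStarAlgEquiv.toStarAlgHom.comp (R q).subtype).codRestrict (R q)
    fun x => conj_mem q u hu x.2

/-- The shift `α`, the automorphism of `R_q` with `α(a_i) = a_{i+1}`. -/
def shift : R q ≃⋆ₐ[ℂ] R q :=
  StarAlgEquiv.ofStarAlgHom
    (conjHom q bilateralShift fun i => ⟨_, bilateralShift_stdBasis i⟩)
    (conjHom q bilateralShift.symm fun i => ⟨_, bilateralShift_symm_stdBasis i⟩)
    (StarAlgHom.ext fun x => Subtype.ext
      ((secondQuantization q bilateralShift).conjStarAlgEquiv.symm_apply_apply x.1))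
    (StarAlgHom.ext fun x => Subtype.ext
      ((secondQuantization q bilateralShift).conjStarAlgEquiv.apply_symm_apply x.1))

theorem shift_ann (i : ℤ) : shift q (ann q i) = ann q (i + 1) := by
  refine Subtype.ext ?_
  change (secondQuantization q bilateralShift).conjStarAlgEquiv (annihilator q (stdBasis i)) = _
  rw [conj_annihilator, bilateralShift_stdBasis]
  rfl

theorem shift_cre (i : ℤ) : shift q (cre q i) = cre q (i + 1) := by
  refine Subtype.ext ?_
  change (secondQuantization q bilateralShift).conjStarAlgEquiv (creator q (stdBasis i)) = _
  rw [conj_creator, bilateralShift_stdBasis]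
  rfl

end Shift

end QFock

end

/-! The heart of the matter is that for an orthonormal family `f` the row of creators `(a⁺(f_l))_l`
has norm at most `(1 - |q|) ^ (-1/2)`, however many members the family has. Equivalently, by taking
adjoints, the column of annihilators has this bound.

With `c = (1 - |q|)⁻¹`, the row and the column estimates are proved together by induction on the
tensor degree. The `q`-commutation relation and orthonormality turn `‖∑ a⁺(f_l) x_l‖²` into `∑
‖x_l‖²` plus `q` times a sum of inner products of the vectors `a(f_m) x_l`, so it is at most `∑
‖x_l‖² + |q| ∑ ‖a(f_m) x_l‖²` (`PreFock.norm_sum_creator_sq_le_add`). Annihilators lower the degree,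
so the row bound one degree below, converted to a column bound by
`PreFock.sum_norm_annihilator_sq_le_of_row`, estimates the last term by `|q| c ∑ ‖x_l‖²`. Since `1 +
|q| c = c`, the induction closes. Density carries the column bound to the Fock space, and duality
gives back the row bound (`norm_sum_creator_sq_le`).

The powers of the shift translate all indices of a word by `k_l`. If the word begins with a creator,
these first creators belong to distinct basis vectors, hence form a row of squared norm at most `c`.
Each of the remaining `i + j - 1` letters costs a factor `c` in the square, and summing `n` squared
norms gives `n c ^ (i + j)`. A word without creators is the adjoint of a word of creators only. -/

namespace QFock

/-! ### Degree filtration of the span of the simple tensors -/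

namespace PreFock

variable {q : Set.Ioo (-1 : ℝ) 1} {E : Type*}

/-- The span of the simple tensors of degree less than `N`. -/
noncomputable def degreeLT (q : Set.Ioo (-1 : ℝ) 1) (E : Type*) (N : ℕ) : Submodule ℂ (PreFock q E) :=
  Submodule.span ℂ {y | ∃ u : Simple E, u.1 < N ∧ y = tensor q u}

theorem degreeLT_mono {N M : ℕ} (h : N ≤ M) : degreeLT q E N ≤ degreeLT q E M :=
  Submodule.span_mono fun _ ⟨u, hu, hy⟩ => ⟨u, hu.trans_le h, hy⟩

theorem exists_mem_degreeLT (x : PreFock q E) : ∃ N, x ∈ degreeLT q E N := by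
  induction x using induction with
  | h0 => exact ⟨0, zero_mem _⟩
  | hadd x y hx hy =>
    obtain ⟨N, hN⟩ := hx
    obtain ⟨M, hM⟩ := hy
    exact ⟨max N M, add_mem (degreeLT_mono (le_max_left _ _) hN)
      (degreeLT_mono (le_max_right _ _) hM)⟩
  | hsmul c x hx =>
    obtain ⟨N, hN⟩ := hx
    exact ⟨N, Submodule.smul_mem _ _ hN⟩
  | ht u => exact ⟨u.1 + 1, Submodule.subset_span ⟨u, Nat.lt_succ_self _, rfl⟩⟩

variable [NormedAddCommGroup E] [InnerProductSpace ℂ E]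

/-- This loss of one degree is what makes the induction for the row bound well founded. -/
theorem annihilator_mem_degreeLT (f : E) {N : ℕ} {x : PreFock q E}
    (hx : x ∈ degreeLT q E (N + 1)) : annihilator f x ∈ degreeLT q E N := by
  induction hx using Submodule.span_induction with
  | zero => simp
  | add x y _ _ hx hy => rw [map_add]; exact add_mem hx hy
  | smul a x _ hx => rw [map_smul]; exact Submodule.smul_mem _ a hx
  | mem x hx =>
    obtain ⟨⟨n, g⟩, hu, rfl⟩ := hx
    cases n with
    | zero => simp [annihilator]
    | succ n =>
      simp only [annihilator, lift_tensor]
      refine Submodule.sum_mem _ fun k _ => Submodule.smul_mem _ _ (Submodule.subset_span ?_)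
      exact ⟨_, Nat.lt_of_succ_lt_succ hu, rfl⟩

/-! ### Row and column estimates on the span of the simple tensors -/

variable {ι : Type*} [Fintype ι]

/-- A bound of the row of creators `(a⁺(f_l))_l` is, at the vectors `a(f_l) x`, a bound of the
column of annihilators `(a(f_l))_l`. -/
theorem sum_norm_annihilator_sq_le_of_row (f : ι → E) {c : ℝ} (hc : 0 ≤ c) (x : PreFock q E)
    (h : ‖∑ l, creator (f l) (annihilator (f l) x)‖ ^ 2 ≤ c * ∑ l, ‖annihilator (f l) x‖ ^ 2) :
    ∑ l, ‖annihilator (f l) x‖ ^ 2 ≤ c * ‖x‖ ^ 2 := by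
  set S := ∑ l, ‖annihilator (f l) x‖ ^ 2 with hS
  have hS0 : 0 ≤ S := Finset.sum_nonneg fun l _ => sq_nonneg _
  -- Moving each annihilator across as a creator makes `S` the quadratic form of `∑ a⁺(f_l) a(f_l)`
  -- at `x`.
  have e : (S : ℂ) = inner ℂ (∑ l, creator (f l) (annihilator (f l) x)) x := by
    rw [sum_inner, hS]
    push_cast
    refine Finset.sum_congr rfl fun l _ => ?_
    rw [inner_creator_left, inner_self_eq_norm_sq_to_K]
    rfl
  have h1 : S ≤ ‖∑ l, creator (f l) (annihilator (f l) x)‖ * ‖x‖ := by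
    have := norm_inner_le_norm (𝕜 := ℂ) (∑ l, creator (f l) (annihilator (f l) x)) x
    rwa [← e, Complex.norm_real, Real.norm_of_nonneg hS0] at this
  -- Cauchy–Schwarz and the row bound give `S² ≤ c S ‖x‖²`, from which a nonzero `S` cancels.
  rcases hS0.eq_or_lt with h0 | h0
  · rw [← h0]; positivity
  · have h2 : S ^ 2 ≤ c * S * ‖x‖ ^ 2 := by
      calc S ^ 2 ≤ (‖∑ l, creator (f l) (annihilator (f l) x)‖ * ‖x‖) ^ 2 := by gcongr
        _ = ‖∑ l, creator (f l) (annihilator (f l) x)‖ ^ 2 * ‖x‖ ^ 2 := by ring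
        _ ≤ c * S * ‖x‖ ^ 2 := by gcongr
    nlinarith

/-- Move `a⁺(f)` to the right, commute it past `a⁺(g)` by the `q`-commutation relation, and move the
remaining `a⁺(g)` back to the left. -/
theorem inner_creator_creator (f g : E) (x y : PreFock q E) :
    (inner ℂ (creator f x) (creator g y) : ℂ) =
      inner ℂ f g * inner ℂ x y + (q : ℝ) * inner ℂ (annihilator g x) (annihilator f y) := by
  rw [inner_creator_left, annihilator_creator, inner_add_right, inner_smul_right,
    inner_smul_right, ← inner_conj_symm x (creator g _), inner_creator_left, inner_conj_symm]

/-- In the expanded square the scalar terms of the commutation relation survive only on the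
diagonal, by orthonormality. The `q`-terms pair `a(f_m) x_l` with `a(f_l) x_m`, and Cauchy–Schwarz
bounds them for either sign of `q`. -/
theorem norm_sum_creator_sq_le_add {f : ι → E} (hf : Orthonormal ℂ f) (x : ι → PreFock q E) :
    ‖∑ l, creator (f l) (x l)‖ ^ 2 ≤
      ∑ l, ‖x l‖ ^ 2 + |(q : ℝ)| * ∑ l, ∑ m, ‖annihilator (f m) (x l)‖ ^ 2 := by
  classical
  have e : (inner ℂ (∑ l, creator (f l) (x l)) (∑ l, creator (f l) (x l)) : ℂ) =
      (∑ l, ‖x l‖ ^ 2 : ℝ) + (q : ℝ) * ∑ l, ∑ m,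
        inner ℂ (annihilator (f m) (x l)) (annihilator (f l) (x m)) := by
    simp only [sum_inner, inner_sum, inner_creator_creator, Finset.sum_add_distrib,
      orthonormal_iff_ite.1 hf, ite_mul, one_mul, zero_mul, Finset.sum_ite_eq',
      Finset.mem_univ, if_true, ← Finset.mul_sum]
    refine congrArg₂ (· + ·) ?_ ?_
    · push_cast
      exact Finset.sum_congr rfl fun l _ => inner_self_eq_norm_sq_to_K _
    · rw [Finset.sum_comm]
  have h1 : ‖(∑ l, ∑ m, inner ℂ (annihilator (f m) (x l)) (annihilator (f l) (x m)) : ℂ)‖ ≤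
      ∑ l, ∑ m, ‖annihilator (f m) (x l)‖ ^ 2 := by
    -- The double sum is symmetrized in `l` and `m` so that `‖u‖ ‖v‖ ≤ (‖u‖² + ‖v‖²) / 2` applies
    -- term by term.
    have h2 : ∑ l, ∑ m, ‖annihilator (f m) (x l)‖ ^ 2 = ∑ l, ∑ m,
        (‖annihilator (f m) (x l)‖ ^ 2 + ‖annihilator (f l) (x m)‖ ^ 2) / 2 := by
      simp only [add_div, Finset.sum_add_distrib]
      rw [Finset.sum_comm (f := fun l m => ‖annihilator (f l) (x m)‖ ^ 2 / 2)]
      simp only [← Finset.sum_add_distrib, add_halves]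
    rw [h2]
    refine (norm_sum_le _ _).trans (Finset.sum_le_sum fun l _ =>
      (norm_sum_le _ _).trans (Finset.sum_le_sum fun m _ => (norm_inner_le_norm _ _).trans ?_))
    nlinarith [sq_nonneg (‖annihilator (f m) (x l)‖ - ‖annihilator (f l) (x m)‖)]
  have h3 : ‖(inner ℂ (∑ l, creator (f l) (x l)) (∑ l, creator (f l) (x l)) : ℂ)‖ =
      ‖∑ l, creator (f l) (x l)‖ ^ 2 := by
    rw [inner_self_eq_norm_sq_to_K]; simp
  rw [← h3, e]
  refine (norm_add_le _ _).trans ?_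
  rw [norm_mul, Complex.norm_real, Complex.norm_real, Real.norm_eq_abs (q : ℝ),
    Real.norm_of_nonneg (Finset.sum_nonneg fun l _ => sq_nonneg _)]
  gcongr

/-- Induction on the degree with a constant independent of `N`; the hypothesis must cover all
families of vectors, since it is applied to the families `(a(f_m) x_l)_m`. -/
theorem norm_sum_creator_sq_le_of_mem_degreeLT {f : ι → E} (hf : Orthonormal ℂ f) (N : ℕ)
    (x : ι → PreFock q E) (hx : ∀ l, x l ∈ degreeLT q E N) :
    ‖∑ l, creator (f l) (x l)‖ ^ 2 ≤ (1 - |(q : ℝ)|)⁻¹ * ∑ l, ‖x l‖ ^ 2 := by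
  have hq : 0 < 1 - |(q : ℝ)| := sub_pos.2 (abs_lt.2 q.2)
  set c := (1 - |(q : ℝ)|)⁻¹ with hc
  have hc0 : 0 ≤ c := by positivity
  -- The constant is the fixed point of `c ↦ 1 + |q| c`, so it is reproduced by the induction step.
  have hcq : 1 + |(q : ℝ)| * c = c := by rw [hc]; field_simp; ring
  induction N generalizing x with
  | zero =>
    have h0 : ∀ l, x l = 0 := fun l => by simpa [degreeLT] using hx l
    simp [h0]
  | succ N ih =>
    refine (norm_sum_creator_sq_le_add hf x).trans ?_
    have h1 : ∑ l, ∑ m, ‖annihilator (f m) (x l)‖ ^ 2 ≤ ∑ l, c * ‖x l‖ ^ 2 :=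
      Finset.sum_le_sum fun l _ => sum_norm_annihilator_sq_le_of_row f hc0 _
        (ih _ fun m => annihilator_mem_degreeLT (f m) (hx l))
    rw [← Finset.mul_sum] at h1
    calc _ ≤ ∑ l, ‖x l‖ ^ 2 + |(q : ℝ)| * (c * ∑ l, ‖x l‖ ^ 2) := by gcongr
      _ = (1 + |(q : ℝ)| * c) * ∑ l, ‖x l‖ ^ 2 := by ring
      _ = c * ∑ l, ‖x l‖ ^ 2 := by rw [hcq]

theorem sum_norm_annihilator_sq_le {f : ι → E} (hf : Orthonormal ℂ f) (x : PreFock q E) :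
    ∑ l, ‖annihilator (f l) x‖ ^ 2 ≤ (1 - |(q : ℝ)|)⁻¹ * ‖x‖ ^ 2 := by
  have hq : 0 < 1 - |(q : ℝ)| := sub_pos.2 (abs_lt.2 q.2)
  obtain ⟨N, hN⟩ := exists_mem_degreeLT x
  -- The row bound is needed only at the vectors `a(f_l) x`, which have bounded degree.
  exact sum_norm_annihilator_sq_le_of_row f (by positivity) x
    (norm_sum_creator_sq_le_of_mem_degreeLT hf N _ fun l =>
      annihilator_mem_degreeLT (f l) (degreeLT_mono N.le_succ hN))

end PreFock

/-! ### Row and column estimates on the Fock space -/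

section Fock

variable (q : Set.Ioo (-1 : ℝ) 1) {E : Type*} [NormedAddCommGroup E] [InnerProductSpace ℂ E]
  {ι : Type*} [Fintype ι]

/-- The column of annihilators of an orthonormal family is bounded by `(1 - |q|) ^ (-1/2)`. -/
theorem sum_norm_annihilator_sq_le {f : ι → E} (hf : Orthonormal ℂ f) (x : Fock q E) :
    ∑ l, ‖annihilator q (f l) x‖ ^ 2 ≤ (1 - |(q : ℝ)|)⁻¹ * ‖x‖ ^ 2 := by
  induction x using UniformSpace.Completion.induction_on with
  | hp => exact isClosed_le (by fun_prop) (by fun_prop)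
  | ih x =>
    simp only [annihilator_coe, UniformSpace.Completion.norm_coe]
    exact PreFock.sum_norm_annihilator_sq_le hf x

/-- The row of creators of an orthonormal family is bounded by `(1 - |q|) ^ (-1/2)`. -/
theorem norm_sum_creator_sq_le {f : ι → E} (hf : Orthonormal ℂ f) (x : ι → Fock q E) :
    ‖∑ l, creator q (f l) (x l)‖ ^ 2 ≤ (1 - |(q : ℝ)|)⁻¹ * ∑ l, ‖x l‖ ^ 2 := by
  have hq : 0 < 1 - |(q : ℝ)| := sub_pos.2 (abs_lt.2 q.2)
  set y := ∑ l, creator q (f l) (x l) with hy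
  set c := (1 - |(q : ℝ)|)⁻¹ with hc
  have hc0 : 0 ≤ c := by positivity
  -- The row is the adjoint of the column: pairing `y` with itself brings in the column at `y`,
  -- whose bound is already known.
  have e : (inner ℂ y y : ℂ) = ∑ l, inner ℂ (x l) (annihilator q (f l) y) := by
    conv_lhs => rw [hy, sum_inner]
    exact Finset.sum_congr rfl fun l _ =>
      (ContinuousLinearMap.adjoint_inner_right (creator q (f l)) _ _).symm
  have h1 : ‖y‖ ^ 2 ≤ ∑ l, ‖x l‖ * ‖annihilator q (f l) y‖ := by
    have h2 : ‖(inner ℂ y y : ℂ)‖ = ‖y‖ ^ 2 := by rw [inner_self_eq_norm_sq_to_K]; simp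
    rw [← h2, e]
    exact (norm_sum_le _ _).trans (Finset.sum_le_sum fun l _ => norm_inner_le_norm _ _)
  have h3 := Finset.sum_mul_sq_le_sq_mul_sq Finset.univ (fun l => ‖x l‖)
    (fun l => ‖annihilator q (f l) y‖)
  have h4 := sum_norm_annihilator_sq_le q hf y
  have hx0 : 0 ≤ ∑ l, ‖x l‖ ^ 2 := Finset.sum_nonneg fun l _ => sq_nonneg _
  have h5 : (‖y‖ ^ 2) ^ 2 ≤ (∑ l, ‖x l‖ ^ 2) * (c * ‖y‖ ^ 2) :=
    (pow_le_pow_left₀ (sq_nonneg _) h1 2).trans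
      (h3.trans (mul_le_mul_of_nonneg_left h4 hx0))
  -- A nonzero `‖y‖²` cancels from `‖y‖⁴ ≤ c ‖y‖² ∑ ‖x_l‖²`.
  rcases (norm_nonneg y).eq_or_lt with h | h
  · rw [← h, zero_pow two_ne_zero]; positivity
  · have : 0 < ‖y‖ ^ 2 := by positivity
    nlinarith

/-- A single unit vector is an orthonormal family, so this is a row of length one. -/
theorem norm_creator_sq_le (f : E) (hf : ‖f‖ = 1) (x : Fock q E) :
    ‖creator q f x‖ ^ 2 ≤ (1 - |(q : ℝ)|)⁻¹ * ‖x‖ ^ 2 := by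
  have h := norm_sum_creator_sq_le q (ι := Unit) (f := fun _ => f)
    ⟨fun _ => hf, fun i j hij => (hij (Subsingleton.elim i j)).elim⟩ fun _ => x
  simpa using h

theorem norm_annihilator_sq_le (f : E) (hf : ‖f‖ = 1) (x : Fock q E) :
    ‖annihilator q f x‖ ^ 2 ≤ (1 - |(q : ℝ)|)⁻¹ * ‖x‖ ^ 2 := by
  have h := sum_norm_annihilator_sq_le q (ι := Unit) (f := fun _ => f)
    ⟨fun _ => hf, fun i j hij => (hij (Subsingleton.elim i j)).elim⟩ x
  simpa using h

end Fock

/-! ### Products of operators, their adjoints, and the canonical basis -/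

theorem norm_list_prod_apply_sq_le {F : Type*} [NormedAddCommGroup F] [NormedSpace ℂ F] {c : ℝ}
    (hc : 0 ≤ c) (L : List (F →L[ℂ] F)) (h : ∀ T ∈ L, ∀ x, ‖T x‖ ^ 2 ≤ c * ‖x‖ ^ 2) (x : F) :
    ‖L.prod x‖ ^ 2 ≤ c ^ L.length * ‖x‖ ^ 2 := by
  induction L with
  | nil => simp
  | cons T L ih =>
    rw [List.prod_cons, List.length_cons, pow_succ' c]
    calc ‖T (L.prod x)‖ ^ 2 ≤ c * ‖L.prod x‖ ^ 2 := h T List.mem_cons_self _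
      _ ≤ c * (c ^ L.length * ‖x‖ ^ 2) := by
        gcongr
        exact ih fun S hS => h S (List.mem_cons_of_mem _ hS)
      _ = c * c ^ L.length * ‖x‖ ^ 2 := by ring

theorem star_prod_ofFn {M : Type*} [Monoid M] [StarMul M] {n : ℕ} (x : Fin n → M) :
    star (List.ofFn x).prod = (List.ofFn fun s => star (x s.rev)).prod := by
  induction n with
  | zero => simp
  | succ n ih =>
    rw [List.ofFn_succ, List.prod_cons, star_mul, ih, List.ofFn_succ', List.concat_eq_append,
      List.prod_append]
    simp [Fin.rev_castSucc]

theorem orthonormal_stdBasis : Orthonormal ℂ stdBasis := by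
  rw [orthonormal_iff_ite]
  intro i j
  rw [stdBasis, lp.inner_single_left, stdBasis, lp.single_apply, Pi.single_apply]
  simp

/-! ### Words in creators and annihilators under the shift -/

section Words

variable (q : Set.Ioo (-1 : ℝ) 1)

theorem iterate_shift_cre (m : ℕ) (i : ℤ) : (shift q)^[m] (cre q i) = cre q (i + m) := by
  induction m with
  | zero => simp
  | succ m ih =>
    rw [Function.iterate_succ_apply', ih, shift_cre]
    push_cast
    rw [add_assoc]

theorem iterate_shift_ann (m : ℕ) (i : ℤ) : (shift q)^[m] (ann q i) = ann q (i + m) := by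
  induction m with
  | zero => simp
  | succ m ih =>
    rw [Function.iterate_succ_apply', ih, shift_ann]
    push_cast
    rw [add_assoc]

theorem iterate_shift_list_prod (m : ℕ) (L : List (R q)) :
    (shift q)^[m] L.prod = (L.map (shift q)^[m]).prod := by
  induction L with
  | nil => simp [iterate_map_one]
  | cons x L ih => rw [List.prod_cons, iterate_map_mul, ih, List.map_cons, List.prod_cons]

theorem star_cre (i : ℤ) : star (cre q i) = ann q i :=
  Subtype.ext (ContinuousLinearMap.star_eq_adjoint _)

theorem star_iterate_shift (m : ℕ) (x : R q) : star ((shift q)^[m] x) = (shift q)^[m] (star x) := by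
  induction m with
  | zero => rfl
  | succ m ih =>
    rw [Function.iterate_succ_apply', Function.iterate_succ_apply', ← ih]
    exact ((shift q).map_star' _).symm

theorem norm_prod_cre_apply_sq_le {i : ℕ} (σ : Fin i → ℤ) (x : Fock q H) :
    ‖((List.ofFn fun s => cre q (σ s)).prod : Fock q H →L[ℂ] Fock q H) x‖ ^ 2 ≤
      (1 - |(q : ℝ)|)⁻¹ ^ i * ‖x‖ ^ 2 := by
  have hq : 0 < 1 - |(q : ℝ)| := sub_pos.2 (abs_lt.2 q.2)
  have h := norm_list_prod_apply_sq_le (c := (1 - |(q : ℝ)|)⁻¹) (by positivity)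
    (List.ofFn fun s => creator q (stdBasis (σ s)))
    (by
      intro T hT y
      obtain ⟨s, rfl⟩ := List.mem_ofFn.1 hT
      exact norm_creator_sq_le q _ (orthonormal_stdBasis.1 _) y) x
  have e : (((List.ofFn fun s => cre q (σ s)).prod : R q) : Fock q H →L[ℂ] Fock q H) =
      (List.ofFn fun s => creator q (stdBasis (σ s))).prod := by
    change (R q).subtype _ = _
    rw [map_list_prod, List.map_ofFn]
    rfl
  rw [List.length_ofFn] at h
  rwa [e]

theorem norm_prod_ann_apply_sq_le {j : ℕ} (ρ : Fin j → ℤ) (x : Fock q H) :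
    ‖((List.ofFn fun s => ann q (ρ s)).prod : Fock q H →L[ℂ] Fock q H) x‖ ^ 2 ≤
      (1 - |(q : ℝ)|)⁻¹ ^ j * ‖x‖ ^ 2 := by
  have hq : 0 < 1 - |(q : ℝ)| := sub_pos.2 (abs_lt.2 q.2)
  have h := norm_list_prod_apply_sq_le (c := (1 - |(q : ℝ)|)⁻¹) (by positivity)
    (List.ofFn fun s => annihilator q (stdBasis (ρ s)))
    (by
      intro T hT y
      obtain ⟨s, rfl⟩ := List.mem_ofFn.1 hT
      exact norm_annihilator_sq_le q _ (orthonormal_stdBasis.1 _) y) x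
  have e : (((List.ofFn fun s => ann q (ρ s)).prod : R q) : Fock q H →L[ℂ] Fock q H) =
      (List.ofFn fun s => annihilator q (stdBasis (ρ s))).prod := by
    change (R q).subtype _ = _
    rw [map_list_prod, List.map_ofFn]
    rfl
  rw [List.length_ofFn] at h
  rwa [e]

/-- The bound for words which begin with a creator. -/
theorem norm_sum_iterate_shift_le {i j : ℕ} (σ : Fin (i + 1) → ℤ) (ρ : Fin j → ℤ) {k : ℕ → ℕ}
    (hk : Function.Injective k) (n : ℕ) :
    ‖∑ l ∈ Finset.range n, (shift q)^[k l] ((List.ofFn fun s => cre q (σ s)).prod *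
        (List.ofFn fun s => ann q (ρ s)).prod)‖ ≤
      √((n : ℝ) / (1 - |(q : ℝ)|) ^ (i + 1 + j)) := by
  have hq : 0 < 1 - |(q : ℝ)| := sub_pos.2 (abs_lt.2 q.2)
  set c := (1 - |(q : ℝ)|)⁻¹ with hc
  have hc0 : 0 ≤ c := by positivity
  -- Injectivity of `k` makes the first letters of the shifted words creators of distinct basis
  -- vectors.
  have hf : Orthonormal ℂ fun l : Fin n => stdBasis (σ 0 + (k l : ℤ)) :=
    orthonormal_stdBasis.comp (fun l : Fin n => σ 0 + (k l : ℤ)) fun l m h =>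
      Fin.ext (hk (by simpa using h))
  -- `A l` and `B l` are the other creators and the annihilators of the shifted word; its first
  -- creator is kept apart for the row estimate.
  let A : Fin n → Fock q H →L[ℂ] Fock q H := fun l =>
    ((List.ofFn fun s : Fin i => cre q (σ s.succ + (k l : ℤ))).prod : R q)
  let B : Fin n → Fock q H →L[ℂ] Fock q H := fun l =>
    ((List.ofFn fun s : Fin j => ann q (ρ s + (k l : ℤ))).prod : R q)
  change ‖((∑ l ∈ Finset.range n, (shift q)^[k l] ((List.ofFn fun s => cre q (σ s)).prod *
        (List.ofFn fun s => ann q (ρ s)).prod) : R q) : Fock q H →L[ℂ] Fock q H)‖ ≤ _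
  refine ContinuousLinearMap.opNorm_le_bound _ (Real.sqrt_nonneg _) fun x => ?_
  have e : ((∑ l ∈ Finset.range n, (shift q)^[k l] ((List.ofFn fun s => cre q (σ s)).prod *
        (List.ofFn fun s => ann q (ρ s)).prod) : R q) : Fock q H →L[ℂ] Fock q H) x =
      ∑ l : Fin n, creator q (stdBasis (σ 0 + (k l : ℤ))) (A l (B l x)) := by
    rw [Finset.sum_range, AddSubmonoidClass.coe_finsetSum, sum_apply]
    refine Finset.sum_congr rfl fun l _ => ?_
    rw [iterate_map_mul, iterate_shift_list_prod, iterate_shift_list_prod, List.map_ofFn,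
      List.map_ofFn, List.ofFn_succ, List.prod_cons]
    simp only [Function.comp_def, iterate_shift_cre, iterate_shift_ann]
    rfl
  rw [e]
  have h1 := norm_sum_creator_sq_le q hf fun l => A l (B l x)
  -- Here the `n` summands are estimated one by one, which is the only source of the factor `n`; the
  -- row of first creators adds just one more `c`.
  have h2 : ∑ l, ‖A l (B l x)‖ ^ 2 ≤ ∑ l : Fin n, c ^ i * (c ^ j * ‖x‖ ^ 2) :=
    Finset.sum_le_sum fun l _ => (norm_prod_cre_apply_sq_le q _ (B l x)).trans
      (mul_le_mul_of_nonneg_left (norm_prod_ann_apply_sq_le q _ x) (pow_nonneg hc0 i))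
  rw [Finset.sum_const, Finset.card_univ, Fintype.card_fin, nsmul_eq_mul] at h2
  refine (pow_le_pow_iff_left₀ (norm_nonneg _)
    (mul_nonneg (Real.sqrt_nonneg _) (norm_nonneg _)) two_ne_zero).1 ?_
  rw [mul_pow, Real.sq_sqrt (by positivity)]
  calc _ ≤ c * (n * (c ^ i * (c ^ j * ‖x‖ ^ 2))) :=
        h1.trans (mul_le_mul_of_nonneg_left h2 hc0)
    _ = n * c ^ (i + 1 + j) * ‖x‖ ^ 2 := by ring
    _ = _ := by rw [hc, inv_pow, div_eq_mul_inv]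

end Words

end QFock

/-! ### The norm estimate for arbitrary nonempty words -/

theorem proposition3p2 (q : Set.Ioo (-1 : ℝ) 1) {i j : ℕ} (hij : 0 < i + j)
    (σ : Fin i → ℤ) (ρ : Fin j → ℤ) (k : ℕ → ℕ) (hk : StrictMono k) (n : ℕ) :
    ‖∑ l ∈ Finset.range n, (QFock.shift q)^[k l]
        ((List.ofFn fun s => QFock.cre q (σ s)).prod *
          (List.ofFn fun s => QFock.ann q (ρ s)).prod)‖ ≤
      √((n : ℝ) / (1 - |(q : ℝ)|) ^ (i + j)) := by
  cases i with
  | succ i => exact QFock.norm_sum_iterate_shift_le q σ ρ hk.injective n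
  | zero =>
    cases j with
    | zero => exact absurd hij (lt_irrefl _)
    | succ j =>
      -- Without creators, pass to the adjoint: it reverses the letters, so the creators are taken
      -- in the order `ρ ∘ Fin.rev`, and the norm is unchanged because the shift commutes with
      -- `star`.
      have h := QFock.norm_sum_iterate_shift_le q (ρ ∘ Fin.rev) (Fin.elim0 : Fin 0 → ℤ)
        hk.injective n
      rw [← norm_star, star_sum] at h
      have e : star ((List.ofFn fun s => QFock.cre q ((ρ ∘ Fin.rev) s)).prod *
          (List.ofFn fun s => QFock.ann q ((Fin.elim0 : Fin 0 → ℤ) s)).prod) =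
          (List.ofFn fun s => QFock.cre q (σ s)).prod *
            (List.ofFn fun s => QFock.ann q (ρ s)).prod := by
        rw [star_mul, QFock.star_prod_ofFn, QFock.star_prod_ofFn]
        simp [QFock.star_cre]
      simpa only [QFock.star_iterate_shift, e, zero_add, add_zero] using h
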